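/- Let $N\ge 3$ be an integer and let $B_1$ be the open unit ball of $\mathbb{R}^N$. Write $w_{rr}(x)=\sum_{i,j=1}^N \frac{x_i x_j}{|x|^2}\,w_{x_i x_j}(x)$ for $x\neq 0$. Suppose that either (1) $0<\gamma<N-2$ and $1<p<\frac{N+2+3\gamma}{N-2-\gamma}$, or (2) $\gamma\ge N-2$ and $1<p<\infty$. Then there is a function $w\in C^\infty(B_1)\cap C^2(\overline{B_1})$ that is positive in $B_1$, radial and strictly decreasing in $|x|$ on $\overline{B_1}$, and that satisfies $$-\Delta w-\gamma\,w_{rr}=w^p\ \text{ in } B_1\setminus\{0\},\qquad w=0\ \text{ on }\partial B_1 .$$ -/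

import Mathlib

open Metric
open scoped ContDiff

noncomputable section

/-- The second order partial derivative `u_{x_i x_j}` at `x`. -/
def secondPartial {N : ℕ} (u : EuclideanSpace ℝ (Fin N) → ℝ) (i j : Fin N)
    (x : EuclideanSpace ℝ (Fin N)) : ℝ :=
  iteratedFDeriv ℝ 2 u x ![EuclideanSpace.single i 1, EuclideanSpace.single j 1]

/-- The operator `L_γ u = Δ u + γ ∑_{i,j} (x_i x_j / |x|²) u_{x_i x_j}`, that is `Δ u + γ u_rr`;
it is meant for `x ≠ 0` only. -/
def cordesOp {N : ℕ} (γ : ℝ) (u : EuclideanSpace ℝ (Fin N) → ℝ)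
    (x : EuclideanSpace ℝ (Fin N)) : ℝ :=
  Laplacian.laplacian u x
    + γ * ∑ i : Fin N, ∑ j : Fin N, x i * x j / ‖x‖ ^ 2 * secondPartial u i j x

/-- `w` is a positive, smooth, radially decreasing (classical) solution of
`-Δ w - γ w_rr = w ^ p` in `B_1 \ {0}`, `w = 0` on `∂B_1`.
Only the values of `w` on the closed unit ball matter. -/
structure IsPosSmoothRadialDecSolution (N : ℕ) (γ p : ℝ)
    (w : EuclideanSpace ℝ (Fin N) → ℝ) : Prop where
  /-- `w` is smooth in the open ball, origin included. -/
  smooth : ContDiffOn ℝ ∞ w (ball 0 1)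
  /-- `w` is `C²` up to the boundary. -/
  contDiffOn_closedBall : ContDiffOn ℝ 2 w (closedBall 0 1)
  pos : ∀ x ∈ ball (0 : EuclideanSpace ℝ (Fin N)) 1, 0 < w x
  radial_decreasing : ∃ v : ℝ → ℝ, StrictAntiOn v (Set.Icc 0 1) ∧
    ∀ x ∈ closedBall (0 : EuclideanSpace ℝ (Fin N)) 1, w x = v ‖x‖
  equation : ∀ x ∈ ball (0 : EuclideanSpace ℝ (Fin N)) 1, x ≠ 0 → -cordesOp γ w x = w x ^ p
  boundary : ∀ x ∈ sphere (0 : EuclideanSpace ℝ (Fin N)) 1, w x = 0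

end

open MeasureTheory Set Filter
open scoped Topology NNReal Interval RealInnerProductSpace

/-! For `w x = G (‖x‖ ^ 2)` and `s = ‖x‖ ^ 2` the operator becomes `4 (1 + γ) (s G'' + a G')` with
`a = (N + γ) / (2 (1 + γ))`: a Laplacian in the fractional dimension `2 a`. Both hypotheses on `p`
say that `a (p - 1) < p + 1`, which is Sobolev subcriticality in that dimension.

So it suffices to solve `s g'' + a g' = -g ^ p`, `g 0 = 1`, up to a first zero `s₀`, and to rescale
`s₀` to `1`. Integrated once, the equation reads `g' = -h`, where `h` is the weighted mean of the
nonlinearity. This form is not singular at `s = 0` and makes sense for negative `s`, so the origin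
becomes an interior point for regularity. With a bounded Lipschitz truncation a contraction gives a
global solution (`exists_hasDerivAt_neg_weightedMean`). If it had no zero, a Pohozaev functional
would start at `0`, increase strictly and yet be bounded by a quantity tending to `0`
(`not_forall_pos_of_subcritical`). Weighted means preserve `C^n`, so `g' = -h` bootstraps to
smoothness where `g > 0`; across the zero, `|g| ^ p` is still `C¹`, which gives `C²`. -/

/-! ### Calculus of weighted means. -/

/-- The weighted mean `∫₀¹ τ ^ (a - 1) φ (s τ) dτ`, i.e. `s ^ (-a) ∫₀ˢ t ^ (a - 1) φ t dt`
for `s > 0`. -/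
noncomputable def weightedMean (a : ℝ) (φ : ℝ → ℝ) (s : ℝ) : ℝ :=
  ∫ τ in (0 : ℝ)..1, τ ^ (a - 1) * φ (s * τ)

theorem intervalIntegrable_rpow_mul {a : ℝ} (ha : 0 < a) {ψ : ℝ → ℝ}
    (hψ : ContinuousOn ψ (Icc 0 1)) :
    IntervalIntegrable (fun τ => τ ^ (a - 1) * ψ τ) volume 0 1 := by
  refine (intervalIntegral.intervalIntegrable_rpow' (by linarith)).mul_continuousOn ?_
  rwa [uIcc_of_le zero_le_one]

theorem aestronglyMeasurable_rpow_mul {a : ℝ} (ha : 0 < a) {ψ : ℝ → ℝ}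
    (hψ : ContinuousOn ψ (Icc 0 1)) :
    AEStronglyMeasurable (fun τ => τ ^ (a - 1) * ψ τ) (volume.restrict (Ι 0 1)) :=
  (intervalIntegrable_iff.1 (intervalIntegrable_rpow_mul ha hψ)).aestronglyMeasurable

theorem integral_rpow_sub_one {a : ℝ} (ha : 0 < a) :
    ∫ τ in (0 : ℝ)..1, τ ^ (a - 1) = 1 / a := by
  rw [integral_rpow (Or.inl (by linarith))]
  simp [Real.zero_rpow ha.ne']

theorem mul_mem_of_convex {I : Set ℝ} (hI : Convex ℝ I) (h0 : (0 : ℝ) ∈ I) {s τ : ℝ}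
    (hs : s ∈ I) (hτ : τ ∈ Icc (0 : ℝ) 1) : s * τ ∈ I := by
  have := hI.smul_mem_of_zero_mem h0 hs hτ
  rwa [smul_eq_mul, mul_comm] at this

theorem continuousOn_comp_mul {I : Set ℝ} (hI : Convex ℝ I) (h0 : (0 : ℝ) ∈ I) {φ : ℝ → ℝ}
    (hφ : ContinuousOn φ I) {s : ℝ} (hs : s ∈ I) :
    ContinuousOn (fun τ => φ (s * τ)) (Icc 0 1) :=
  hφ.comp (by fun_prop) fun _ hτ => mul_mem_of_convex hI h0 hs hτ

theorem weightedMean_continuous {a : ℝ} (ha : 0 < a) {φ : ℝ → ℝ} (hφ : Continuous φ) {C : ℝ}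
    (hC : ∀ t, |φ t| ≤ C) : Continuous (weightedMean a φ) := by
  refine intervalIntegral.continuous_of_dominated_interval
    (bound := fun τ => τ ^ (a - 1) * C) (fun x => ?_) (fun x => ?_)
    (intervalIntegrable_rpow_mul ha continuousOn_const) ?_
  · exact aestronglyMeasurable_rpow_mul ha (ψ := fun τ => φ (x * τ)) (by fun_prop)
  · refine Eventually.of_forall fun τ hτ => ?_
    rw [uIoc_of_le zero_le_one] at hτ
    have h1 : 0 ≤ τ ^ (a - 1) := Real.rpow_nonneg hτ.1.le _
    rw [norm_mul, Real.norm_of_nonneg h1]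
    exact mul_le_mul_of_nonneg_left (hC _) h1
  · exact Eventually.of_forall fun τ _ => by fun_prop

theorem weightedMean_mono {a : ℝ} (ha : 0 < a) {φ ψ : ℝ → ℝ} {s : ℝ}
    (hφ : ContinuousOn (fun τ => φ (s * τ)) (Icc 0 1))
    (hψ : ContinuousOn (fun τ => ψ (s * τ)) (Icc 0 1))
    (h : ∀ τ ∈ Icc (0 : ℝ) 1, φ (s * τ) ≤ ψ (s * τ)) :
    weightedMean a φ s ≤ weightedMean a ψ s := by
  refine intervalIntegral.integral_mono_on zero_le_one (intervalIntegrable_rpow_mul ha hφ)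
    (intervalIntegrable_rpow_mul ha hψ) fun τ hτ => ?_
  exact mul_le_mul_of_nonneg_left (h τ hτ) (Real.rpow_nonneg hτ.1 _)

theorem weightedMean_const {a : ℝ} (ha : 0 < a) (c s : ℝ) :
    weightedMean a (fun _ => c) s = c / a := by
  unfold weightedMean
  rw [intervalIntegral.integral_mul_const, integral_rpow_sub_one ha]
  ring

theorem weightedMean_pos {a : ℝ} (ha : 0 < a) {φ : ℝ → ℝ} {s : ℝ}
    (hφ : ContinuousOn (fun τ => φ (s * τ)) (Icc 0 1))
    (h : ∀ τ ∈ Ioo (0 : ℝ) 1, 0 < φ (s * τ)) : 0 < weightedMean a φ s :=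
  intervalIntegral.intervalIntegral_pos_of_pos_on (intervalIntegrable_rpow_mul ha hφ)
    (fun τ hτ => mul_pos (Real.rpow_pos_of_pos hτ.1 _) (h τ hτ)) zero_lt_one

theorem rpow_sub_one_mul_self {a τ : ℝ} (hτ : 0 < τ) :
    τ ^ (a - 1) * τ = τ ^ (a + 1 - 1) := by
  rw [← Real.rpow_add_one hτ.ne']
  ring_nf

/-- Differentiating under the integral brings out a factor `τ`, which raises the weight from `a` to
`a + 1`. -/
theorem weightedMean_hasDerivAt {a : ℝ} (ha : 0 < a) {I : Set ℝ} (hIo : IsOpen I)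
    (hI : Convex ℝ I) (h0 : (0 : ℝ) ∈ I) {φ : ℝ → ℝ} (hφ : ContDiffOn ℝ 1 φ I) {s : ℝ}
    (hs : s ∈ I) :
    HasDerivAt (weightedMean a φ) (weightedMean (a + 1) (deriv φ) s) s := by
  obtain ⟨δ, hδ, hball⟩ := Metric.nhds_basis_closedBall.mem_iff.1 (hIo.mem_nhds hs)
  have hd : ContinuousOn (deriv φ) I := hφ.continuousOn_deriv_of_isOpen hIo le_rfl
  have hK : IsCompact ((fun q : ℝ × ℝ => q.1 * q.2) '' (closedBall s δ ×ˢ Icc (0 : ℝ) 1)) :=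
    ((isCompact_closedBall s δ).prod isCompact_Icc).image (by fun_prop)
  obtain ⟨M, hM⟩ := hK.exists_bound_of_continuousOn (hd.mono (by
    rintro _ ⟨⟨x, τ⟩, ⟨hx, hτ⟩, rfl⟩
    exact mul_mem_of_convex hI h0 (hball hx) hτ))
  have hint : ∀ x ∈ I, IntervalIntegrable (fun τ => τ ^ (a - 1) * φ (x * τ)) volume 0 1 :=
    fun x hx => intervalIntegrable_rpow_mul ha (continuousOn_comp_mul hI h0 hφ.continuousOn hx)
  have hcd : ContinuousOn (fun τ => deriv φ (s * τ) * τ) (Icc 0 1) :=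
    (continuousOn_comp_mul hI h0 hd hs).mul continuousOn_id
  have key := (intervalIntegral.hasDerivAt_integral_of_dominated_loc_of_deriv_le
    (μ := volume) (a := 0) (b := 1) (x₀ := s)
    (F := fun x τ => τ ^ (a - 1) * φ (x * τ))
    (F' := fun x τ => τ ^ (a - 1) * (deriv φ (x * τ) * τ))
    (bound := fun τ => τ ^ (a - 1) * M) (closedBall_mem_nhds s hδ)
    (Filter.mem_of_superset (hIo.mem_nhds hs) fun x hx =>
      (intervalIntegrable_iff.1 (hint x hx)).aestronglyMeasurable) (hint s hs)
    (aestronglyMeasurable_rpow_mul ha hcd) ?_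
    (intervalIntegrable_rpow_mul ha continuousOn_const) ?_).2
  · refine key.congr_deriv ?_
    refine intervalIntegral.integral_congr_ae (Eventually.of_forall fun τ hτ => ?_)
    rw [uIoc_of_le zero_le_one] at hτ
    simp only [← rpow_sub_one_mul_self hτ.1]
    ring
  · refine Eventually.of_forall fun τ hτ x hx => ?_
    rw [uIoc_of_le zero_le_one] at hτ
    have h1 : 0 ≤ τ ^ (a - 1) := Real.rpow_nonneg hτ.1.le _
    have h2 := hM _ ⟨(x, τ), ⟨hx, Ioc_subset_Icc_self hτ⟩, rfl⟩
    simp only at h2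
    rw [norm_mul, Real.norm_of_nonneg h1, norm_mul, Real.norm_of_nonneg hτ.1.le]
    refine mul_le_mul_of_nonneg_left ?_ h1
    calc _ ≤ ‖deriv φ (x * τ)‖ * 1 := mul_le_mul_of_nonneg_left hτ.2 (norm_nonneg _)
      _ ≤ M := by linarith
  · refine Eventually.of_forall fun τ hτ x hx => ?_
    rw [uIoc_of_le zero_le_one] at hτ
    have hm := mul_mem_of_convex hI h0 (hball hx) (Ioc_subset_Icc_self hτ)
    have h1 : HasDerivAt φ (deriv φ (x * τ)) (x * τ) :=
      ((hφ.differentiableOn one_ne_zero).differentiableAt (hIo.mem_nhds hm)).hasDerivAt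
    have h2 := h1.comp x ((hasDerivAt_id x).mul_const τ)
    simpa using h2.const_mul (τ ^ (a - 1))

/-- The derivative is again a weighted mean, so induction works once `a` is allowed to vary. The
base case needs continuity of that derivative, by dominated convergence. -/
theorem weightedMean_contDiffOn {I : Set ℝ} (hIo : IsOpen I) (hI : Convex ℝ I)
    (h0 : (0 : ℝ) ∈ I) (n : ℕ) : ∀ {a : ℝ}, 0 < a → ∀ {φ : ℝ → ℝ},
    ContDiffOn ℝ (n + 1 : ℕ) φ I → ContDiffOn ℝ (n + 1 : ℕ) (weightedMean a φ) I := by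
  induction n with
  | zero =>
    intro a ha φ hφ
    have hφ' : ContDiffOn ℝ 1 φ I := by simpa using hφ
    have hd : ContinuousOn (deriv φ) I := hφ'.continuousOn_deriv_of_isOpen hIo le_rfl
    have hD := fun s (hs : s ∈ I) => weightedMean_hasDerivAt ha hIo hI h0 hφ' hs
    have : ContDiffOn ℝ (0 + 1) (weightedMean a φ) I := by
      rw [contDiffOn_succ_iff_deriv_of_isOpen hIo]
      refine ⟨fun s hs => (hD s hs).differentiableAt.differentiableWithinAt, by simp, ?_⟩
      rw [contDiffOn_zero]
      refine ContinuousOn.congr (f := weightedMean (a + 1) (deriv φ)) ?_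
        fun s hs => (hD s hs).deriv
      intro s hs
      obtain ⟨δ, hδ, hball⟩ := Metric.nhds_basis_closedBall.mem_iff.1 (hIo.mem_nhds hs)
      have hK : IsCompact
          ((fun q : ℝ × ℝ => q.1 * q.2) '' (closedBall s δ ×ˢ Icc (0 : ℝ) 1)) :=
        ((isCompact_closedBall s δ).prod isCompact_Icc).image (by fun_prop)
      obtain ⟨M, hM⟩ := hK.exists_bound_of_continuousOn (hd.mono (by
        rintro _ ⟨⟨x, τ⟩, ⟨hx, hτ⟩, rfl⟩
        exact mul_mem_of_convex hI h0 (hball hx) hτ))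
      refine (intervalIntegral.continuousAt_of_dominated_interval
        (bound := fun τ => τ ^ (a + 1 - 1) * M) ?_ ?_
        (intervalIntegrable_rpow_mul (by linarith) continuousOn_const) ?_).continuousWithinAt
      · filter_upwards [hIo.mem_nhds hs] with x hx
        exact aestronglyMeasurable_rpow_mul (by linarith) (continuousOn_comp_mul hI h0 hd hx)
      · filter_upwards [closedBall_mem_nhds s hδ] with x hx
        refine Eventually.of_forall fun τ hτ => ?_
        rw [uIoc_of_le zero_le_one] at hτ
        have h1 : 0 ≤ τ ^ (a + 1 - 1) := Real.rpow_nonneg hτ.1.le _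
        rw [norm_mul, Real.norm_of_nonneg h1]
        exact mul_le_mul_of_nonneg_left (hM _ ⟨(x, τ), ⟨hx, Ioc_subset_Icc_self hτ⟩, rfl⟩) h1
      · refine Eventually.of_forall fun τ hτ => ?_
        rw [uIoc_of_le zero_le_one] at hτ
        have hm := mul_mem_of_convex hI h0 hs (Ioc_subset_Icc_self hτ)
        refine continuousAt_const.mul ?_
        exact ContinuousAt.comp (f := fun x => x * τ)
          (hd.continuousAt (hIo.mem_nhds hm)) (by fun_prop)
    simpa using this
  | succ n ih =>
    intro a ha φ hφ
    have hD := fun s (hs : s ∈ I) => weightedMean_hasDerivAt ha hIo hI h0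
      (hφ.of_le (by norm_cast; omega)) hs
    have hφ' : ContDiffOn ℝ ((n + 1 : ℕ) + 1) φ I := by exact_mod_cast hφ
    have : ContDiffOn ℝ ((n + 1 : ℕ) + 1) (weightedMean a φ) I := by
      rw [contDiffOn_succ_iff_deriv_of_isOpen hIo] at hφ' ⊢
      refine ⟨fun s hs => (hD s hs).differentiableAt.differentiableWithinAt, by simp, ?_⟩
      exact (ih (by linarith) hφ'.2.2).congr fun s hs => (hD s hs).deriv
    exact_mod_cast this

/-- Integrate the `τ`-derivative of `τ ^ a * φ (s * τ)` over `[0, 1]`. This recovers the second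
order equation from its integrated form. -/
theorem weightedMean_ode {a : ℝ} (ha : 0 < a) {I : Set ℝ} (hIo : IsOpen I)
    (hI : Convex ℝ I) (h0 : (0 : ℝ) ∈ I) {φ : ℝ → ℝ} (hφ : ContDiffOn ℝ 1 φ I) {s : ℝ}
    (hs : s ∈ I) :
    s * weightedMean (a + 1) (deriv φ) s + a * weightedMean a φ s = φ s := by
  have hd : ContinuousOn (deriv φ) I := hφ.continuousOn_deriv_of_isOpen hIo le_rfl
  have hc := continuousOn_comp_mul hI h0 hφ.continuousOn hs
  have i1 := (intervalIntegrable_rpow_mul (a := a + 1) (by linarith)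
    (continuousOn_comp_mul hI h0 hd hs)).const_mul s
  have i2 := (intervalIntegrable_rpow_mul ha hc).const_mul a
  have key := intervalIntegral.integral_eq_sub_of_hasDerivAt_of_le zero_le_one
    (f := fun τ => τ ^ a * φ (s * τ))
    (f' := fun τ => s * (τ ^ (a + 1 - 1) * deriv φ (s * τ)) + a * (τ ^ (a - 1) * φ (s * τ)))
    ((Real.continuous_rpow_const ha.le).continuousOn.mul hc) (fun τ hτ => ?_) (i1.add i2)
  · rw [intervalIntegral.integral_add i1 i2, intervalIntegral.integral_const_mul,
      intervalIntegral.integral_const_mul] at key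
    simpa [Real.zero_rpow ha.ne', weightedMean] using key
  · have hm := mul_mem_of_convex hI h0 hs (Ioo_subset_Icc_self hτ)
    have h1 : HasDerivAt φ (deriv φ (s * τ)) (s * τ) :=
      ((hφ.differentiableOn one_ne_zero).differentiableAt (hIo.mem_nhds hm)).hasDerivAt
    have h2 : HasDerivAt (fun τ => φ (s * τ)) (deriv φ (s * τ) * (s * 1)) τ :=
      h1.comp τ ((hasDerivAt_id τ).const_mul s)
    refine ((Real.hasDerivAt_rpow_const (p := a) (Or.inl hτ.1.ne')).mul h2).congr_deriv ?_
    rw [show a + 1 - 1 = a by ring]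
    ring

theorem weightedMean_le_add {a : ℝ} (ha : 0 < a) {φ ψ : ℝ → ℝ} {s B : ℝ} (hφ : Continuous φ)
    (hψ : Continuous ψ) (h : ∀ τ ∈ Icc (0 : ℝ) 1, φ (s * τ) ≤ ψ (s * τ) + B) :
    weightedMean a φ s ≤ weightedMean a ψ s + B / a := by
  have h1 := weightedMean_mono (ψ := fun t => ψ t + B) ha (by fun_prop) (by fun_prop) h
  have h2 : weightedMean a (fun t => ψ t + B) s = weightedMean a ψ s + B / a := by
    rw [← weightedMean_const ha B s]
    unfold weightedMean
    rw [← intervalIntegral.integral_add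
      (intervalIntegrable_rpow_mul ha (ψ := fun τ => ψ (s * τ)) (by fun_prop))
      (intervalIntegrable_rpow_mul ha (ψ := fun τ => B) (by fun_prop))]
    simp only [mul_add]
  exact h1.trans h2.le

/-! ### Global solution of the truncated equation. -/

/-- The gain `1 / K` is what makes the Picard map a contraction in an exponentially weighted norm.
-/
theorem abs_integral_le_of_abs_le_exp {f : ℝ → ℝ} {B K : ℝ} (hB : 0 ≤ B) (hK : 0 < K)
    (h : ∀ t, |f t| ≤ B * Real.exp (K * |t|)) (s : ℝ) :
    |∫ t in (0 : ℝ)..s, f t| ≤ B / K * Real.exp (K * |s|) := by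
  have e : s * ∫ τ in (0 : ℝ)..1, f (s * τ) = ∫ t in (0 : ℝ)..s, f t := by
    simp
  rw [← e, ← intervalIntegral.integral_const_mul]
  have hd : ∀ τ : ℝ, HasDerivAt (fun τ => B / K * Real.exp (K * |s| * τ))
      (|s| * (B * Real.exp (K * |s| * τ))) τ := fun τ => by
    have := (((hasDerivAt_id τ).const_mul (K * |s|)).exp).const_mul (B / K)
    refine this.congr_deriv ?_
    simp only [id]
    field_simp
  have hi : IntervalIntegrable (fun τ => |s| * (B * Real.exp (K * |s| * τ))) volume 0 1 :=
    (by fun_prop : Continuous fun τ => |s| * (B * Real.exp (K * |s| * τ))).intervalIntegrable _ _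
  have h1 := intervalIntegral.integral_eq_sub_of_hasDerivAt (fun τ _ => hd τ) hi
  refine (intervalIntegral.norm_integral_le_of_norm_le zero_le_one
    (f := fun τ => s * f (s * τ)) (g := fun τ => |s| * (B * Real.exp (K * |s| * τ)))
    (Eventually.of_forall fun τ hτ => ?_) hi).trans ?_
  · rw [Real.norm_eq_abs, abs_mul]
    refine mul_le_mul_of_nonneg_left ((h _).trans_eq ?_) (abs_nonneg _)
    rw [abs_mul, abs_of_pos hτ.1]
    ring_nf
  · rw [h1]
    have : 0 ≤ B / K * Real.exp (K * |s| * 0) := by positivity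
    simp only [mul_one] at *
    linarith

/-- Global solvability of `s g'' + a g' = -F g`, `g 0 = 1`, in integrated form. -/
theorem exists_hasDerivAt_neg_weightedMean {a : ℝ} (ha : 0 < a) {F : ℝ → ℝ} {L : ℝ≥0}
    (hF : LipschitzWith L F) {C : ℝ} (hC : ∀ v, |F v| ≤ C) :
    ∃ g : ℝ → ℝ, g 0 = 1 ∧ ∀ s, HasDerivAt g (-weightedMean a (fun t => F (g t)) s) s := by
  -- The Picard map has Lipschitz constant `L / (a K)`, which this choice keeps below `1 / 2`.
  obtain ⟨K, hK⟩ : ∃ K : ℝ, K = 2 * (L / a) + 1 := ⟨_, rfl⟩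
  have hLa : 0 ≤ (L : ℝ) / a := by positivity
  have hK0 : 0 < K := by linarith
  have hC0 : 0 ≤ C := (abs_nonneg _).trans (hC 0)
  -- The unknown is `u = exp (-K |t|) g`, so the plain sup norm of `u` is the weighted norm of `g`.
  let G : BoundedContinuousFunction ℝ ℝ → ℝ → ℝ := fun u t => Real.exp (K * |t|) * u t
  let h : BoundedContinuousFunction ℝ ℝ → ℝ → ℝ := fun u => weightedMean a fun t => F (G u t)
  let P : BoundedContinuousFunction ℝ ℝ → ℝ → ℝ := fun u s => 1 - ∫ t in (0 : ℝ)..s, h u t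
  have hG : ∀ u, Continuous (G u) := fun u => by
    have := u.continuous
    fun_prop
  have hFG : ∀ u, Continuous fun t => F (G u t) := fun u => hF.continuous.comp (hG u)
  have hh : ∀ u, Continuous (h u) := fun u =>
    weightedMean_continuous ha (hFG u) fun t => hC _
  have hhb : ∀ u s, |h u s| ≤ C / a := fun u s => by
    rw [abs_le, ← neg_div, ← weightedMean_const ha C s, ← weightedMean_const ha (-C) s]
    have hc : ContinuousOn (fun τ => F (G u (s * τ))) (Icc 0 1) :=
      ((hFG u).comp (continuous_const.mul continuous_id)).continuousOn
    exact ⟨weightedMean_mono ha continuousOn_const hc fun τ _ => (abs_le.1 (hC _)).1,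
      weightedMean_mono ha hc continuousOn_const fun τ _ => (abs_le.1 (hC _)).2⟩
  have hP : ∀ u s, HasDerivAt (P u) (-h u s) s := fun u s =>
    (intervalIntegral.integral_hasDerivAt_right ((hh u).intervalIntegrable _ _)
      ((hh u).stronglyMeasurableAtFilter _ _) (hh u).continuousAt).const_sub 1
  have hPc : ∀ u, Continuous (P u) := fun u =>
    continuous_iff_continuousAt.2 fun s => (hP u s).continuousAt
  let T : BoundedContinuousFunction ℝ ℝ → BoundedContinuousFunction ℝ ℝ := fun u =>
    BoundedContinuousFunction.ofNormedAddCommGroup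
      (fun s => Real.exp (-(K * |s|)) * P u s)
      ((by fun_prop : Continuous fun s : ℝ => Real.exp (-(K * |s|))).mul (hPc u))
      (1 + C / a / K) (fun s => by
        have h1 : |P u s| ≤ 1 + C / a * |s| := by
          have h2 := intervalIntegral.norm_integral_le_of_norm_le_const (a := 0) (b := s)
            (f := h u) (C := C / a) fun t _ => hhb u t
          rw [sub_zero, Real.norm_eq_abs] at h2
          have h3 := abs_sub 1 (∫ t in (0 : ℝ)..s, h u t)
          rw [abs_one] at h3
          exact h3.trans (by linarith)
        have h4 : Real.exp (-(K * |s|)) * Real.exp (K * |s|) = 1 := by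
          rw [← Real.exp_add]; simp
        have h5 := Real.add_one_le_exp (K * |s|)
        have h6 : 0 < Real.exp (-(K * |s|)) := Real.exp_pos _
        have h7 : 0 ≤ K * |s| := by positivity
        have h8 : 1 + C / a * |s| ≤ (1 + C / a / K) * Real.exp (K * |s|) := by
          have : C / a * |s| = C / a / K * (K * |s|) := by field_simp
          have h9 : 0 ≤ C / a / K := by positivity
          rw [this]
          nlinarith
        rw [norm_mul, Real.norm_of_nonneg h6.le, Real.norm_eq_abs]
        calc _ ≤ Real.exp (-(K * |s|)) * ((1 + C / a / K) * Real.exp (K * |s|)) :=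
              mul_le_mul_of_nonneg_left (h1.trans h8) h6.le
          _ = (1 + C / a / K) * (Real.exp (-(K * |s|)) * Real.exp (K * |s|)) := by ring
          _ = _ := by rw [h4, mul_one])
  have hT : ContractingWith (1 / 2) T := by
    refine ⟨by rw [div_lt_one] <;> norm_num, LipschitzWith.of_dist_le_mul fun u v => ?_⟩
    have hd0 : 0 ≤ dist u v := dist_nonneg
    rw [BoundedContinuousFunction.dist_le (by positivity)]
    intro s
    have hdiff : ∀ u v : BoundedContinuousFunction ℝ ℝ, ∀ t,
        h u t ≤ h v t + L / a * dist u v * Real.exp (K * |t|) := by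
      intro u v t
      have := weightedMean_le_add ha (hFG u) (hFG v) (s := t)
        (B := L * dist u v * Real.exp (K * |t|)) fun τ hτ => by
          have h1 := hF.dist_le_mul (G u (t * τ)) (G v (t * τ))
          have h2 := BoundedContinuousFunction.dist_coe_le_dist (f := u) (g := v) (t * τ)
          rw [Real.dist_eq] at h1 h2
          have h3 : |G u (t * τ) - G v (t * τ)| ≤ Real.exp (K * |t|) * dist u v := by
            simp only [G, ← mul_sub]
            rw [abs_mul, abs_of_pos (Real.exp_pos _)]
            refine mul_le_mul ?_ h2 (abs_nonneg _) (Real.exp_pos _).le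
            rw [Real.exp_le_exp, abs_mul, abs_of_nonneg hτ.1]
            exact mul_le_mul_of_nonneg_left
              (mul_le_of_le_one_right (abs_nonneg _) hτ.2) hK0.le
          have h4 := mul_le_mul_of_nonneg_left h3 L.coe_nonneg
          have h5 := (abs_le.1 h1).2
          rw [Real.dist_eq] at h5
          linarith
      refine this.trans_eq ?_
      simp only [h]
      ring
    have habs := abs_integral_le_of_abs_le_exp (f := fun t => h v t - h u t)
      (B := L / a * dist u v) (by positivity) hK0 (fun t => by
        have h1 := hdiff u v t
        have h2 := hdiff v u t
        rw [dist_comm v u] at h2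
        rw [abs_le]
        constructor <;> linarith) s
    rw [intervalIntegral.integral_sub ((hh v).intervalIntegrable _ _)
      ((hh u).intervalIntegrable _ _)] at habs
    have h4 : Real.exp (-(K * |s|)) * Real.exp (K * |s|) = 1 := by
      rw [← Real.exp_add]; simp
    have h6 : 0 < Real.exp (-(K * |s|)) := Real.exp_pos _
    have e : T u s - T v s = Real.exp (-(K * |s|)) *
        ((∫ t in (0 : ℝ)..s, h v t) - ∫ t in (0 : ℝ)..s, h u t) := by
      simp only [T, P, BoundedContinuousFunction.coe_ofNormedAddCommGroup]
      ring
    rw [Real.dist_eq, e, abs_mul, abs_of_pos h6]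
    calc _ ≤ Real.exp (-(K * |s|)) * (L / a * dist u v / K * Real.exp (K * |s|)) :=
          mul_le_mul_of_nonneg_left habs h6.le
      _ = L / a / K * dist u v * (Real.exp (-(K * |s|)) * Real.exp (K * |s|)) := by ring
      _ = L / a / K * dist u v := by rw [h4, mul_one]
      _ ≤ 1 / 2 * dist u v := by
          refine mul_le_mul_of_nonneg_right ?_ hd0
          rw [div_le_iff₀ hK0]
          linarith
      _ = _ := by norm_num
  obtain ⟨u, hu, -⟩ := hT.exists_fixedPoint 0 (edist_ne_top _ _)
  have hGP : G u = P u := by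
    ext s
    have h1 : u s = Real.exp (-(K * |s|)) * P u s := by
      conv_lhs => rw [← hu.eq]
      rfl
    simp only [G]
    rw [h1, ← mul_assoc, ← Real.exp_add]
    simp
  refine ⟨G u, ?_, fun s => ?_⟩
  · rw [hGP]; simp [P]
  · have := hP u s
    rw [← hGP] at this
    exact this

/-- The cutoff `2` lies above the initial value `1`, so it stays inactive on `[0, s₀]` and slightly
beyond both ends. -/
theorem exists_lipschitzWith_min_rpow {p : ℝ} (hp : 1 < p) :
    ∃ L : ℝ≥0, LipschitzWith L fun v : ℝ => min |v| 2 ^ p := by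
  have h1 : ContDiff ℝ 1 fun x : ℝ => x ^ p :=
    Real.contDiff_rpow_const_of_le (n := 1) (by simpa using hp.le)
  obtain ⟨L, hL⟩ := h1.contDiffOn.exists_lipschitzOnWith one_ne_zero (convex_Icc (0 : ℝ) 2)
    isCompact_Icc
  refine ⟨L, LipschitzWith.of_dist_le_mul fun x y => ?_⟩
  have hm : ∀ v : ℝ, min |v| 2 ∈ Icc (0 : ℝ) 2 := fun v =>
    ⟨le_min (abs_nonneg _) zero_le_two, min_le_right _ _⟩
  refine (hL.dist_le_mul _ (hm x) _ (hm y)).trans ?_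
  refine mul_le_mul_of_nonneg_left ?_ L.coe_nonneg
  rw [Real.dist_eq, Real.dist_eq]
  refine (abs_min_sub_min_le_max _ _ _ _).trans ?_
  simpa using abs_abs_sub_abs_le x y

/-! ### Pohozaev identity and subcritical nonexistence. -/

/-- A Pohozaev identity for `g' = -h`, `s h' + a h = g ^ p`. -/
theorem hasDerivAt_pohozaev {a p : ℝ} (hp : 1 < p) {g h : ℝ → ℝ} {s h' : ℝ} (hs : 0 < s)
    (hgs : 0 < g s) (hg : HasDerivAt g (-h s) s) (hh : HasDerivAt h h' s)
    (hode : s * h' + a * h s = g s ^ p) :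
    HasDerivAt (fun s => s ^ a * (s * h s ^ 2 + 2 / (p + 1) * g s ^ (p + 1)
      - 2 * a / (p + 1) * (g s * h s)))
      ((1 - a + 2 * a / (p + 1)) * (s ^ (a - 1) * s * h s ^ 2)) s := by
  have hp1 : p + 1 ≠ 0 := by linarith
  have h1 : HasDerivAt (fun s : ℝ => s ^ a) (a * s ^ (a - 1)) s :=
    Real.hasDerivAt_rpow_const (Or.inl hs.ne')
  have h2 : HasDerivAt (fun s => g s ^ (p + 1)) (-h s * (p + 1) * g s ^ (p + 1 - 1)) s :=
    hg.rpow_const (Or.inl hgs.ne')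
  have h3 := h1.mul ((((hasDerivAt_id s).mul (hh.pow 2)).add (h2.const_mul (2 / (p + 1)))).sub
    ((hg.mul hh).const_mul (2 * a / (p + 1))))
  refine h3.congr_deriv ?_
  have e1 : g s ^ (p + 1) = g s ^ p * g s := Real.rpow_add_one hgs.ne' p
  have e2 : s ^ a = s ^ (a - 1) * s := by
    rw [← Real.rpow_add_one hs.ne']; ring_nf
  have e3 : g s ^ (p + 1 - 1) = g s ^ p := by ring_nf
  simp only [Pi.add_apply, Pi.sub_apply, Pi.mul_apply, Pi.pow_apply, id, e1, e2, e3, ← hode]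
  field_simp
  ring

/-- Subcritical nonexistence: no solution of `g' = -h`, `s h' + a h = g ^ p` stays positive. -/
theorem not_forall_pos_of_subcritical {a p : ℝ} (ha : 0 < a) (hp : 1 < p)
    (hap : a * (p - 1) < p + 1) {g h h' : ℝ → ℝ} (hgc : ContinuousOn g (Ici 0))
    (hhc : ContinuousOn h (Ici 0)) (hg : ∀ s, 0 < s → HasDerivAt g (-h s) s)
    (hh : ∀ s, 0 < s → HasDerivAt h (h' s) s)
    (hode : ∀ s, 0 < s → s * h' s + a * h s = g s ^ p)
    (hpos : ∀ s, 0 ≤ s → 0 < g s) (hhpos : ∀ s, 0 < s → 0 < h s)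
    (hlow : ∀ s, 0 < s → g s ^ p / a ≤ h s) : False := by
  have hp1 : 0 < p - 1 := by linarith
  -- decay of `g`
  have hdec : ∀ s, 0 < s → s * g s ^ (p - 1) ≤ a / (p - 1) := by
    -- The bound `h ≥ g ^ p / a` gives `(g ^ (1 - p))' ≥ (p - 1) / a`.
    have hmono : MonotoneOn (fun s => g s ^ (1 - p) - (p - 1) / a * s) (Ici 0) := by
      refine monotoneOn_of_hasDerivWithinAt_nonneg (convex_Ici 0)
        (f' := fun s => -h s * (1 - p) * g s ^ (1 - p - 1) - (p - 1) / a * 1) ?_ ?_ ?_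
      · exact (hgc.rpow_const fun s hs => Or.inl (hpos s hs).ne').sub
          (continuousOn_const.mul continuousOn_id)
      · intro s hs
        rw [interior_Ici, mem_Ioi] at hs
        exact (((hg s hs).rpow_const (Or.inl (hpos s hs.le).ne')).sub
          ((hasDerivAt_id s).const_mul _)).hasDerivWithinAt
      · intro s hs
        rw [interior_Ici, mem_Ioi] at hs
        have h1 := hlow s hs
        have h2 : 0 < g s ^ p := Real.rpow_pos_of_pos (hpos s hs.le) _
        have h3 : g s ^ (1 - p - 1) = (g s ^ p)⁻¹ := by
          rw [← Real.rpow_neg (hpos s hs.le).le]; ring_nf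
        rw [h3, sub_nonneg]
        have : (p - 1) / a * 1 = (p - 1) * (g s ^ p / a) * (g s ^ p)⁻¹ := by field_simp
        rw [this]
        have h4 : (p - 1) * (g s ^ p / a) ≤ (p - 1) * h s :=
          mul_le_mul_of_nonneg_left h1 hp1.le
        calc _ ≤ (p - 1) * h s * (g s ^ p)⁻¹ :=
              mul_le_mul_of_nonneg_right h4 (inv_nonneg.2 h2.le)
          _ = _ := by ring
    intro s hs
    have h1 := hmono (mem_Ici.2 le_rfl) (mem_Ici.2 hs.le) hs.le
    simp only [mul_zero, sub_zero] at h1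
    have h2 : 0 < g 0 ^ (1 - p) := Real.rpow_pos_of_pos (hpos 0 le_rfl) _
    have h3 : g s ^ (1 - p) = (g s ^ (p - 1))⁻¹ := by
      rw [← Real.rpow_neg (hpos s hs.le).le]; ring_nf
    have h4 : 0 < g s ^ (p - 1) := Real.rpow_pos_of_pos (hpos s hs.le) _
    have h5 : (p - 1) / a * s ≤ (g s ^ (p - 1))⁻¹ := by rw [← h3]; linarith
    rw [le_inv_comm₀ (by positivity) h4] at h5
    calc s * g s ^ (p - 1) ≤ s * ((p - 1) / a * s)⁻¹ := mul_le_mul_of_nonneg_left h5 hs.le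
      _ = _ := by field_simp
  -- decay of `h`
  have hhdec : ∀ s, 0 < s → s * h s ≤ 2 ^ a * g s := by
    have hmono : MonotoneOn (fun s => s ^ a * h s) (Ioi 0) := by
      have hd : ∀ s, 0 < s → HasDerivAt (fun s => s ^ a * h s)
          (a * s ^ (a - 1) * h s + s ^ a * h' s) s := fun s hs =>
        (Real.hasDerivAt_rpow_const (Or.inl hs.ne')).mul (hh s hs)
      refine monotoneOn_of_hasDerivWithinAt_nonneg (convex_Ioi 0)
        (f' := fun s => a * s ^ (a - 1) * h s + s ^ a * h' s)
        (fun s hs => (hd s hs).continuousAt.continuousWithinAt) ?_ ?_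
      · intro s hs
        rw [interior_Ioi, mem_Ioi] at hs
        exact (hd s hs).hasDerivWithinAt
      · intro s hs
        rw [interior_Ioi, mem_Ioi] at hs
        have e2 : s ^ a = s ^ (a - 1) * s := by
          rw [← Real.rpow_add_one hs.ne']; ring_nf
        have e3 : a * s ^ (a - 1) * h s + s ^ a * h' s = s ^ (a - 1) * g s ^ p := by
          rw [e2, ← hode s hs]; ring
        rw [e3]
        exact mul_nonneg (Real.rpow_nonneg hs.le _) (Real.rpow_nonneg (hpos s hs.le).le _)
    intro s hs
    -- On `[s, 2 s]` the mean value theorem bounds `h ξ` by `g s / s`; monotonicity of `s ^ a * h s`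
    -- carries this back to `s` at the cost of `2 ^ a`.
    obtain ⟨ξ, hξ, hmv⟩ := exists_hasDerivAt_eq_slope g (fun s => -h s)
      (show s < 2 * s by linarith)
      (hgc.mono fun t ht => mem_Ici.2 (hs.le.trans ht.1)) fun t ht => hg t (hs.trans ht.1)
    have hξ0 : 0 < ξ := hs.trans hξ.1
    have h1 := hmono (mem_Ioi.2 hs) (mem_Ioi.2 hξ0) hξ.1.le
    have h2 : ξ ^ a ≤ 2 ^ a * s ^ a := by
      rw [← Real.mul_rpow zero_le_two hs.le]
      exact Real.rpow_le_rpow hξ0.le hξ.2.le ha.le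
    have h3 : s ^ a * h s ≤ 2 ^ a * s ^ a * h ξ :=
      h1.trans (mul_le_mul_of_nonneg_right h2 (hhpos ξ hξ0).le)
    have h4 : h s ≤ 2 ^ a * h ξ := by
      refine le_of_mul_le_mul_left ?_ (Real.rpow_pos_of_pos hs a)
      linarith
    have h5 : s * h ξ ≤ g s := by
      rw [eq_div_iff (by linarith)] at hmv
      have := hpos (2 * s) (by linarith)
      linarith
    have h6 : (0 : ℝ) < 2 ^ a := Real.rpow_pos_of_pos zero_lt_two a
    calc s * h s ≤ s * (2 ^ a * h ξ) := mul_le_mul_of_nonneg_left h4 hs.le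
      _ = 2 ^ a * (s * h ξ) := by ring
      _ ≤ 2 ^ a * g s := mul_le_mul_of_nonneg_left h5 h6.le
  -- monotonicity of the Pohozaev functional
  set Q : ℝ → ℝ := fun s => s ^ a * (s * h s ^ 2 + 2 / (p + 1) * g s ^ (p + 1)
      - 2 * a / (p + 1) * (g s * h s)) with hQ
  -- Subcriticality enters here, and again in the sign of the decay exponent of `Q`.
  have hcoef : 0 < 1 - a + 2 * a / (p + 1) := by
    have : 1 - a + 2 * a / (p + 1) = (p + 1 - a * (p - 1)) / (p + 1) := by
      field_simp; ring
    rw [this]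
    exact div_pos (by linarith) (by linarith)
  have hQmono : StrictMonoOn Q (Ici 0) := by
    refine strictMonoOn_of_hasDerivWithinAt_pos (convex_Ici 0)
      (f' := fun s => (1 - a + 2 * a / (p + 1)) * (s ^ (a - 1) * s * h s ^ 2)) ?_ ?_ ?_
    · have h1 : ContinuousOn (fun s => g s ^ (p + 1)) (Ici 0) :=
        hgc.rpow_const fun s hs => Or.inl (hpos s hs).ne'
      exact (Real.continuous_rpow_const ha.le).continuousOn.mul
        (((continuousOn_id.mul (hhc.pow 2)).add (continuousOn_const.mul h1)).sub
          (continuousOn_const.mul (hgc.mul hhc)))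
    · intro s hs
      rw [interior_Ici, mem_Ioi] at hs
      exact (hasDerivAt_pohozaev hp hs (hpos s hs.le) (hg s hs) (hh s hs)
        (hode s hs)).hasDerivWithinAt
    · intro s hs
      rw [interior_Ici, mem_Ioi] at hs
      have := hhpos s hs
      have := Real.rpow_pos_of_pos hs (a - 1)
      positivity
  have hQ0 : Q 0 = 0 := by simp [hQ, Real.zero_rpow ha.ne']
  have hQ1 : 0 < Q 1 := hQ0 ▸ hQmono (mem_Ici.2 le_rfl) (mem_Ici.2 zero_le_one) zero_lt_one
  -- decay of the Pohozaev functional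
  set C₀ := a / (p - 1) with hC₀
  have hC₀pos : 0 < C₀ := div_pos ha hp1
  set C₁ := (2 ^ a) ^ 2 + 2 / (p + 1) * C₀ with hC₁
  have hC₁pos : 0 < C₁ := by positivity
  have hQle : ∀ s, 0 < s →
      Q s ≤ C₁ * C₀ ^ (2 / (p - 1)) * s ^ (-((p + 1) / (p - 1) - a)) := by
    intro s hs
    have hgs := hpos s hs.le
    have h1 : s * h s ^ 2 ≤ (2 ^ a) ^ 2 * (g s ^ 2 / s) := by
      have := pow_le_pow_left₀ (mul_pos hs (hhpos s hs)).le (hhdec s hs) 2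
      rw [← mul_div_assoc, le_div_iff₀ hs]
      linarith
    have h2 : g s ^ (p + 1) ≤ C₀ * (g s ^ 2 / s) := by
      have e : g s ^ (p + 1) = g s ^ (p - 1) * g s ^ 2 := by
        rw [← Real.rpow_natCast, ← Real.rpow_add hgs]; norm_num; ring_nf
      rw [e, ← mul_div_assoc, le_div_iff₀ hs]
      have := mul_le_mul_of_nonneg_right (hdec s hs) (sq_nonneg (g s))
      linarith
    have h3 : 0 ≤ 2 * a / (p + 1) * (g s * h s) := by
      have := hhpos s hs
      positivity
    have h4 : g s ^ 2 ≤ C₀ ^ (2 / (p - 1)) * s ^ (-(2 / (p - 1))) := by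
      have e : g s ^ 2 = (g s ^ (p - 1)) ^ (2 / (p - 1)) := by
        rw [← Real.rpow_mul hgs.le, mul_div_cancel₀ _ hp1.ne']; norm_num
      have e' : C₀ ^ (2 / (p - 1)) * s ^ (-(2 / (p - 1))) = (C₀ / s) ^ (2 / (p - 1)) := by
        rw [Real.div_rpow hC₀pos.le hs.le, Real.rpow_neg hs.le]; rfl
      rw [e, e']
      refine Real.rpow_le_rpow (Real.rpow_nonneg hgs.le _) ?_ (by positivity)
      rw [le_div_iff₀ hs]
      linarith [hdec s hs]
    have h5 : s * h s ^ 2 + 2 / (p + 1) * g s ^ (p + 1) - 2 * a / (p + 1) * (g s * h s)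
        ≤ C₁ * (g s ^ 2 / s) := by
      have : 2 / (p + 1) * g s ^ (p + 1) ≤ 2 / (p + 1) * (C₀ * (g s ^ 2 / s)) :=
        mul_le_mul_of_nonneg_left h2 (by positivity)
      rw [hC₁]
      linarith
    have hsa : 0 < s ^ a := Real.rpow_pos_of_pos hs a
    calc Q s ≤ s ^ a * (C₁ * (g s ^ 2 / s)) := mul_le_mul_of_nonneg_left h5 hsa.le
      _ ≤ s ^ a * (C₁ * (C₀ ^ (2 / (p - 1)) * s ^ (-(2 / (p - 1))) / s)) := by gcongr
      _ = C₁ * C₀ ^ (2 / (p - 1)) * (s ^ a * s ^ (-(2 / (p - 1))) * s ^ (-1 : ℝ)) := by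
          rw [Real.rpow_neg_one]; ring
      _ = _ := by
          rw [← Real.rpow_add hs, ← Real.rpow_add hs]
          congr 2
          field_simp
          ring
  have hlim : Tendsto (fun s : ℝ => C₁ * C₀ ^ (2 / (p - 1)) *
      s ^ (-((p + 1) / (p - 1) - a))) atTop (𝓝 0) := by
    have : 0 < (p + 1) / (p - 1) - a := by
      rw [sub_pos, lt_div_iff₀ hp1]; exact hap
    simpa using (tendsto_rpow_neg_atTop this).const_mul (C₁ * C₀ ^ (2 / (p - 1)))
  obtain ⟨s, hs1, hs2⟩ := ((hlim.eventually_lt_const hQ1).and (eventually_ge_atTop 1)).exists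
  have h1 := hQmono.monotoneOn (mem_Ici.2 zero_le_one) (mem_Ici.2 (by linarith)) hs2
  linarith [hQle s (by linarith)]

/-! ### The profile up to its first zero. -/

/-- `g` is the profile, in the variable `s = r ^ 2`, of a positive decreasing solution of the
Lane–Emden equation `s g'' + a g' = -g ^ p` with first zero `s₀`. -/
structure IsLaneEmdenProfile (a p : ℝ) (g : ℝ → ℝ) (s₀ ε : ℝ) : Prop where
  zero_pos : 0 < s₀
  eps_pos : 0 < ε
  smooth : ContDiffOn ℝ ∞ g (Ioo (-ε) s₀)
  contDiffOn_two : ContDiffOn ℝ 2 g (Ioo (-ε) (s₀ + ε))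
  pos : ∀ s ∈ Ico 0 s₀, 0 < g s
  eq_zero : g s₀ = 0
  strictAntiOn : StrictAntiOn g (Icc 0 s₀)
  ode : ∀ s ∈ Ioo 0 s₀, s * deriv (deriv g) s + a * deriv g s = -g s ^ p

theorem exists_laneEmdenProfile {a p : ℝ} (ha : 0 < a) (hp : 1 < p)
    (hap : a * (p - 1) < p + 1) : ∃ g s₀ ε, IsLaneEmdenProfile a p g s₀ ε := by
  obtain ⟨L, hL⟩ := exists_lipschitzWith_min_rpow hp
  have hF0 : ∀ v : ℝ, 0 ≤ min |v| 2 ^ p := fun v =>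
    Real.rpow_nonneg (le_min (abs_nonneg _) zero_le_two) _
  have hFb : ∀ v : ℝ, |min |v| 2 ^ p| ≤ 2 ^ p := fun v => by
    rw [abs_of_nonneg (hF0 v)]
    exact Real.rpow_le_rpow (le_min (abs_nonneg _) zero_le_two) (min_le_right _ _) (by linarith)
  obtain ⟨g, hg0, hg⟩ := exists_hasDerivAt_neg_weightedMean ha hL hFb
  set φ : ℝ → ℝ := fun t => min |g t| 2 ^ p with hφ
  set h : ℝ → ℝ := weightedMean a φ with hh
  have hgc : Continuous g := continuous_iff_continuousAt.2 fun s => (hg s).continuousAt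
  have hφc : Continuous φ := hL.continuous.comp hgc
  have hhc : Continuous h := weightedMean_continuous ha hφc fun t => hFb _
  have hderiv : deriv g = fun s => -h s := funext fun s => (hg s).deriv
  have hgd : Differentiable ℝ g := fun s => (hg s).differentiableAt
  have hg1 : ContDiff ℝ 1 g := by
    rw [contDiff_one_iff_deriv, hderiv]
    exact ⟨hgd, hhc.neg⟩
  have hφs : ∀ s, ContinuousOn (fun τ => φ (s * τ)) (Icc 0 1) := fun s => by fun_prop
  have hh0 : ∀ s, 0 ≤ h s := fun s => by
    have := weightedMean_mono ha (φ := fun _ => 0) continuousOn_const (hφs s)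
      fun τ _ => hF0 (g (s * τ))
    rwa [weightedMean_const ha, zero_div] at this
  have hanti : Antitone g := antitone_of_deriv_nonpos hgd fun s => by
    rw [hderiv]; exact neg_nonpos.2 (hh0 s)
  have hle1 : ∀ s, 0 ≤ s → g s ≤ 1 := fun s hs => hg0 ▸ hanti hs
  have hge1 : ∀ s, s ≤ 0 → 1 ≤ g s := fun s hs => hg0 ▸ hanti hs
  have hφeq : ∀ s, |g s| < 2 → φ s = |g s| ^ p := fun s hs => by
    simp only [hφ, min_eq_left hs.le]
  -- Where the cutoff is inactive the nonlinearity is `|g| ^ p`, which is `C¹` even at a zero of `g`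
  -- because `p > 1`.
  have hreg : ∀ I : Set ℝ, (∀ s ∈ I, |g s| < 2) → ContDiffOn ℝ 1 φ I := by
    intro I hI2
    exact ((contDiff_norm_rpow hp).comp hg1).contDiffOn.congr fun s hs => hφeq s (hI2 s hs)
  have hnear : ∀ s, |g s| < 2 → ∃ δ > 0, ∀ t, |t - s| < δ → |g t| < 2 := by
    intro s hs
    have := (hgc.abs.continuousAt (x := s)).eventually_lt_const hs
    obtain ⟨δ, hδ, hball⟩ := Metric.eventually_nhds_iff.1 this
    exact ⟨δ, hδ, fun t ht => hball (by rwa [Real.dist_eq])⟩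
  obtain ⟨δ, hδ, hδg⟩ := hnear 0 (by rw [hg0]; norm_num)
  have hneg : ∀ t, -δ < t → t ≤ 0 → |g t| < 2 := fun t h1 h2 => hδg t (by
    rw [sub_zero, abs_lt]; exact ⟨h1, by linarith⟩)
  have hzero : ∃ s, 0 ≤ s ∧ g s = 0 := by
    by_contra! hne
    have hpos : ∀ s, 0 ≤ s → 0 < g s := by
      intro s hs
      by_contra! hle
      obtain ⟨t, ht, ht0⟩ := intermediate_value_Icc' hs hgc.continuousOn
        (show (0 : ℝ) ∈ Icc (g s) (g 0) from ⟨hle, by rw [hg0]; exact zero_le_one⟩)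
      exact hne t ht.1 ht0
    have hlt : ∀ s ∈ Ioi (-δ), |g s| < 2 := by
      intro s hs
      rcases le_total s 0 with h0 | h0
      · exact hneg s hs h0
      · rw [abs_of_pos (hpos s h0)]; linarith [hle1 s h0]
    have hφ1 := hreg _ hlt
    have h0I : (0 : ℝ) ∈ Ioi (-δ) := by simpa using hδ
    have hmem : ∀ s, 0 < s → s ∈ Ioi (-δ) := fun s hs => by simp only [mem_Ioi]; linarith
    have hφp : ∀ s, 0 ≤ s → φ s = g s ^ p := fun s hs => by
      rw [hφeq s (hlt s (by simp only [mem_Ioi]; linarith)), abs_of_pos (hpos s hs)]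
    refine not_forall_pos_of_subcritical ha hp hap hgc.continuousOn hhc.continuousOn
      (fun s _ => hg s)
      (fun s hs => weightedMean_hasDerivAt ha isOpen_Ioi (convex_Ioi _) h0I hφ1 (hmem s hs))
      (fun s hs => ?_) hpos (fun s hs => ?_) (fun s hs => ?_)
    · rw [weightedMean_ode ha isOpen_Ioi (convex_Ioi _) h0I hφ1 (hmem s hs), hφp s hs.le]
    · refine weightedMean_pos ha (hφs s) fun τ hτ => ?_
      rw [hφp _ (mul_nonneg hs.le hτ.1.le)]
      exact Real.rpow_pos_of_pos (hpos _ (mul_nonneg hs.le hτ.1.le)) _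
    · rw [← weightedMean_const ha (g s ^ p) s]
      refine weightedMean_mono ha continuousOn_const (hφs s) fun τ hτ => ?_
      rw [hφp _ (mul_nonneg hs.le hτ.1)]
      exact Real.rpow_le_rpow (hpos s hs.le).le
        (hanti (mul_le_of_le_one_right hs.le hτ.2)) (by linarith)
  obtain ⟨s₀, hs₀, hgs₀, hfirst⟩ : ∃ s₀, 0 ≤ s₀ ∧ g s₀ = 0 ∧ ∀ s, 0 ≤ s → s < s₀ → g s ≠ 0 := by
    have hcl : IsClosed {s | 0 ≤ s ∧ g s = 0} :=
      isClosed_Ici.inter (isClosed_singleton.preimage hgc)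
    have hbdd : BddBelow {s | 0 ≤ s ∧ g s = 0} := ⟨0, fun s hs => hs.1⟩
    have hmem := hcl.csInf_mem hzero hbdd
    exact ⟨_, hmem.1, hmem.2, fun s h1 h2 h3 => (csInf_le hbdd ⟨h1, h3⟩).not_gt h2⟩
  have hs₀pos : 0 < s₀ := hs₀.lt_of_ne (by rintro rfl; rw [hg0] at hgs₀; exact one_ne_zero hgs₀)
  have hpos : ∀ s, s < s₀ → 0 < g s := by
    intro s hs
    rcases le_total s 0 with h0 | h0
    · linarith [hge1 s h0]
    · exact (hgs₀ ▸ hanti hs.le : 0 ≤ g s).lt_of_ne (hfirst s h0 hs).symm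
  obtain ⟨δ', hδ', hδg'⟩ := hnear s₀ (by rw [hgs₀]; norm_num)
  set ε := min δ δ' with hε
  have hεpos : 0 < ε := lt_min hδ hδ'
  have hlt : ∀ s ∈ Ioo (-ε) (s₀ + ε), |g s| < 2 := by
    intro s hs
    have h1 := hs.1
    have h2 := hs.2
    have h3 : ε ≤ δ := min_le_left _ _
    have h4 : ε ≤ δ' := min_le_right _ _
    rcases le_total s 0 with h0 | h0
    · exact hneg s (by linarith) h0
    · rcases lt_or_ge s s₀ with h5 | h5
      · rw [abs_of_pos (hpos s h5)]; linarith [hle1 s h0]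
      · exact hδg' s (by rw [abs_of_nonneg (by linarith)]; linarith)
  have hφ1 := hreg _ hlt
  have h0I : (0 : ℝ) ∈ Ioo (-ε) (s₀ + ε) := ⟨by linarith, by linarith⟩
  have h0J : (0 : ℝ) ∈ Ioo (-ε) s₀ := ⟨by linarith, hs₀pos⟩
  have hJI : Ioo (-ε) s₀ ⊆ Ioo (-ε) (s₀ + ε) := Ioo_subset_Ioo_right (by linarith)
  have hφp : ∀ s ∈ Ioo (-ε) s₀, φ s = g s ^ p := fun s hs => by
    rw [hφeq s (hlt s (hJI hs)), abs_of_pos (hpos s hs.2)]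
  have hsucc : ∀ (n : ℕ) (I : Set ℝ), IsOpen I → ContDiffOn ℝ n h I →
      ContDiffOn ℝ (n + 1 : ℕ) g I := by
    intro n I hI hn
    have : ContDiffOn ℝ (n + 1) g I := by
      rw [contDiffOn_succ_iff_deriv_of_isOpen hI, hderiv]
      exact ⟨hgd.differentiableOn, by simp, hn.neg⟩
    exact_mod_cast this
  refine ⟨g, s₀, ε, hs₀pos, hεpos, ?_, ?_, fun s hs => hpos s hs.2, hgs₀, ?_, ?_⟩
  -- Bootstrap: `g` of class `C^(n+1)` and positive makes `g ^ p`, hence its mean `h = -g'`, of the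
  -- same class.
  · have hall : ∀ n : ℕ, ContDiffOn ℝ (n + 1 : ℕ) g (Ioo (-ε) s₀) := by
      intro n
      induction n with
      | zero => exact_mod_cast hg1.contDiffOn
      | succ n ih =>
        refine hsucc _ _ isOpen_Ioo
          (weightedMean_contDiffOn isOpen_Ioo (convex_Ioo _ _) h0J n ha ?_)
        exact (ih.rpow_const_of_ne (p := p) fun s hs => (hpos s hs.2).ne').congr hφp
    rw [contDiffOn_infty]
    exact fun n => (hall n).of_le (by norm_cast; omega)
  · have := hsucc 1 _ isOpen_Ioo (by
      simpa using weightedMean_contDiffOn isOpen_Ioo (convex_Ioo _ _) h0I 0 ha (by simpa using hφ1))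
    exact_mod_cast this
  · refine strictAntiOn_of_deriv_neg (convex_Icc _ _) hgc.continuousOn fun s hs => ?_
    rw [interior_Icc] at hs
    rw [hderiv]
    refine neg_neg_of_pos (weightedMean_pos ha (hφs s) fun τ hτ => ?_)
    have h1 : 0 < s * τ := mul_pos hs.1 hτ.1
    have h2 : s * τ < s₀ := (mul_le_of_le_one_right hs.1.le hτ.2.le).trans_lt hs.2
    rw [hφp _ ⟨by linarith, h2⟩]
    exact Real.rpow_pos_of_pos (hpos _ h2) _
  · intro s hs
    have hsI : s ∈ Ioo (-ε) (s₀ + ε) := ⟨by linarith [hs.1], by linarith [hs.2]⟩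
    have h1 := weightedMean_hasDerivAt ha isOpen_Ioo (convex_Ioo _ _) h0I hφ1 hsI
    have h2 := weightedMean_ode ha isOpen_Ioo (convex_Ioo _ _) h0I hφ1 hsI
    rw [hφp s ⟨by linarith [hs.1], hs.2⟩] at h2
    have h3 : deriv (fun s => -h s) s = -weightedMean (a + 1) (deriv φ) s := h1.neg.deriv
    rw [hderiv, h3, ← h2]
    ring

/-! ### The operator on functions of `‖x‖ ^ 2`. -/

theorem hasFDerivAt_comp_norm_sq {E : Type*} [NormedAddCommGroup E] [InnerProductSpace ℝ E]
    {G : ℝ → ℝ} {G' : ℝ} {x : E} (hG : HasDerivAt G G' (‖x‖ ^ 2)) :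
    HasFDerivAt (fun y : E => G (‖y‖ ^ 2)) ((2 * G') • innerSL ℝ x) x := by
  have h := hG.comp_hasFDerivAt x (hasStrictFDerivAt_norm_sq x).hasFDerivAt
  refine h.congr_fderiv ?_
  ext v
  simp
  ring

theorem iteratedFDeriv_two_comp_norm_sq {E : Type*} [NormedAddCommGroup E]
    [InnerProductSpace ℝ E] {G : ℝ → ℝ} {I : Set ℝ} (hI : IsOpen I) (hG : ContDiffOn ℝ 2 G I)
    {x : E} (hx : ‖x‖ ^ 2 ∈ I) (u v : E) :
    iteratedFDeriv ℝ 2 (fun y : E => G (‖y‖ ^ 2)) x ![u, v] =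
      4 * deriv (deriv G) (‖x‖ ^ 2) * ⟪x, u⟫ * ⟪x, v⟫ + 2 * deriv G (‖x‖ ^ 2) * ⟪u, v⟫ := by
  have hd : ∀ t ∈ I, HasDerivAt G (deriv G t) t := fun t ht =>
    ((hG.differentiableOn two_ne_zero).differentiableAt (hI.mem_nhds ht)).hasDerivAt
  have hG' : ContDiffOn ℝ 1 (deriv G) I := by
    have h2 : ContDiffOn ℝ (1 + 1) G I := by rwa [one_add_one_eq_two]
    exact (contDiffOn_succ_iff_deriv_of_isOpen hI).1 h2 |>.2.2
  have hd2 : HasDerivAt (deriv G) (deriv (deriv G) (‖x‖ ^ 2)) (‖x‖ ^ 2) :=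
    ((hG'.differentiableOn one_ne_zero).differentiableAt (hI.mem_nhds hx)).hasDerivAt
  have hev : fderiv ℝ (fun y : E => G (‖y‖ ^ 2)) =ᶠ[𝓝 x]
      fun y => (2 * deriv G (‖y‖ ^ 2)) • innerSL ℝ y := by
    have hcont : ContinuousAt (fun y : E => ‖y‖ ^ 2) x := by fun_prop
    filter_upwards [hcont.preimage_mem_nhds (hI.mem_nhds hx)] with y hy
    exact (hasFDerivAt_comp_norm_sq (hd _ hy)).fderiv
  -- `innerSL` is typed as conjugate-linear; `J` is the same map with a plain real-linear type.
  obtain ⟨J, hJ⟩ : ∃ J : E →L[ℝ] E →L[ℝ] ℝ, ∀ y, J y = innerSL ℝ y := ⟨innerSL ℝ, fun _ => rfl⟩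
  have h2 : HasFDerivAt (fun y : E => (2 * deriv G (‖y‖ ^ 2)) • J y)
      ((2 * deriv G (‖x‖ ^ 2)) • J +
        ((2 : ℝ) • ((2 * deriv (deriv G) (‖x‖ ^ 2)) • innerSL ℝ x)).smulRight (J x)) x :=
    ((hasFDerivAt_comp_norm_sq hd2).const_mul 2).smul J.hasFDerivAt
  simp only [← hJ] at hev
  rw [iteratedFDeriv_two_apply, hev.fderiv_eq, h2.fderiv]
  simp [hJ]
  ring

theorem cordesOp_comp_norm_sq {N : ℕ} (γ : ℝ) {G : ℝ → ℝ} {I : Set ℝ} (hI : IsOpen I)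
    (hG : ContDiffOn ℝ 2 G I) {x : EuclideanSpace ℝ (Fin N)} (hx : ‖x‖ ^ 2 ∈ I) (hx0 : x ≠ 0) :
    cordesOp γ (fun y => G (‖y‖ ^ 2)) x =
      4 * (1 + γ) * (‖x‖ ^ 2 * deriv (deriv G) (‖x‖ ^ 2)) +
        2 * (N + γ) * deriv G (‖x‖ ^ 2) := by
  set A := deriv (deriv G) (‖x‖ ^ 2)
  set B := deriv G (‖x‖ ^ 2)
  have hn : ∑ i, x i ^ 2 = ‖x‖ ^ 2 := by
    rw [EuclideanSpace.norm_sq_eq]; simp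
  have hne : ‖x‖ ^ 2 ≠ 0 := pow_ne_zero 2 (norm_ne_zero_iff.2 hx0)
  have hsp : ∀ i j, secondPartial (fun y : EuclideanSpace ℝ (Fin N) => G (‖y‖ ^ 2)) i j x =
      4 * A * x i * x j + 2 * B * if i = j then 1 else 0 := by
    intro i j
    rw [secondPartial, iteratedFDeriv_two_comp_norm_sq hI hG hx]
    simp [EuclideanSpace.inner_single_right, PiLp.single_apply, A, B]
    simp [eq_comm]
  have hlap : Laplacian.laplacian (fun y : EuclideanSpace ℝ (Fin N) => G (‖y‖ ^ 2)) x =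
      4 * A * ‖x‖ ^ 2 + 2 * B * N := by
    rw [InnerProductSpace.laplacian_eq_iteratedFDeriv_orthonormalBasis _
      (EuclideanSpace.basisFun (Fin N) ℝ)]
    have : ∀ i, iteratedFDeriv ℝ 2 (fun y : EuclideanSpace ℝ (Fin N) => G (‖y‖ ^ 2)) x
        ![EuclideanSpace.basisFun (Fin N) ℝ i, EuclideanSpace.basisFun (Fin N) ℝ i] =
        4 * A * x i ^ 2 + 2 * B := by
      intro i
      have := hsp i i
      rw [secondPartial] at this
      simp only [EuclideanSpace.basisFun_apply, this]
      simp
      ring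
    simp only [this, Finset.sum_add_distrib, ← Finset.mul_sum, hn]
    simp
    ring
  have hrr : ∑ i, ∑ j, x i * x j / ‖x‖ ^ 2 *
      secondPartial (fun y : EuclideanSpace ℝ (Fin N) => G (‖y‖ ^ 2)) i j x =
      4 * A * ‖x‖ ^ 2 + 2 * B := by
    have h1 : ∀ i, ∑ j, x i * x j / ‖x‖ ^ 2 *
        secondPartial (fun y : EuclideanSpace ℝ (Fin N) => G (‖y‖ ^ 2)) i j x =
        (4 * A + 2 * B / ‖x‖ ^ 2) * x i ^ 2 := by
      intro i
      have h2 : ∀ j, x i * x j / ‖x‖ ^ 2 *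
          secondPartial (fun y : EuclideanSpace ℝ (Fin N) => G (‖y‖ ^ 2)) i j x =
          4 * A * x i ^ 2 / ‖x‖ ^ 2 * x j ^ 2 +
            if i = j then 2 * B / ‖x‖ ^ 2 * (x i * x j) else 0 := by
        intro j
        rw [hsp]
        split_ifs <;> ring
      simp only [h2, Finset.sum_add_distrib, ← Finset.mul_sum, hn, Finset.sum_ite_eq,
        Finset.mem_univ, if_true]
      field_simp
    simp only [h1, ← Finset.mul_sum, hn]
    field_simp
  rw [cordesOp, hlap, hrr]
  ring

/-! ### Rescaling to the unit ball. -/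

theorem exists_isPosSmoothRadialDecSolution {N : ℕ} {γ p : ℝ} (hγ : 0 < γ) (hp : 1 < p)
    (hsub : (N + γ) * (p - 1) < 2 * (1 + γ) * (p + 1)) :
    ∃ w : EuclideanSpace ℝ (Fin N) → ℝ, IsPosSmoothRadialDecSolution N γ p w := by
  have h1γ : 0 < 1 + γ := by linarith
  have hNγ : 0 < N + γ := by positivity
  obtain ⟨g, s₀, ε, hg⟩ := exists_laneEmdenProfile (a := (N + γ) / (2 * (1 + γ))) (p := p)
    (by positivity) hp (by rw [div_mul_eq_mul_div, div_lt_iff₀ (by positivity)]; linarith)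
  have hs₀ := hg.zero_pos
  have hε := hg.eps_pos
  have hp1 : 0 < p - 1 := by linarith
  -- For `w = c g(s₀ ‖x‖ ^ 2)` the left side of the equation is `4 (1 + γ) s₀ c g ^ p`; this `c`
  -- turns it into `w ^ p`.
  obtain ⟨c, hc, hcp⟩ : ∃ c : ℝ, 0 < c ∧ c ^ p = c * (4 * (1 + γ) * s₀) := by
    have hb : 0 < 4 * (1 + γ) * s₀ := by positivity
    refine ⟨(4 * (1 + γ) * s₀) ^ (1 / (p - 1)), Real.rpow_pos_of_pos hb _, ?_⟩
    rw [← Real.rpow_mul hb.le, ← Real.rpow_add_one hb.ne']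
    congr 1
    field_simp
    ring
  set G : ℝ → ℝ := fun t => c * g (s₀ * t) with hG
  have hscale : ∀ {n : ℕ∞ω} {I : Set ℝ}, ContDiffOn ℝ n g I →
      ContDiffOn ℝ n G ((fun t => s₀ * t) ⁻¹' I) := fun {n I} h =>
    contDiffOn_const.mul (h.comp (contDiff_const.mul contDiff_id).contDiffOn fun t ht => ht)
  have hns : ∀ {n : ℕ∞ω}, ContDiff ℝ n fun y : EuclideanSpace ℝ (Fin N) => ‖y‖ ^ 2 :=
    fun {n} => contDiff_norm_sq ℝ
  have hball : ∀ x ∈ ball (0 : EuclideanSpace ℝ (Fin N)) 1, s₀ * ‖x‖ ^ 2 ∈ Ico 0 s₀ := by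
    intro x hx
    rw [mem_ball_zero_iff] at hx
    have : ‖x‖ ^ 2 < 1 := pow_lt_one₀ (norm_nonneg _) hx two_ne_zero
    exact ⟨by positivity, by nlinarith⟩
  have hcball : ∀ r ∈ Icc (0 : ℝ) 1, s₀ * r ^ 2 ∈ Icc 0 s₀ := fun r hr =>
    ⟨by positivity, mul_le_of_le_one_right hs₀.le (pow_le_one₀ hr.1 hr.2)⟩
  refine ⟨fun x => G (‖x‖ ^ 2), ?_, ?_, ?_, ⟨fun r => G (r ^ 2), ?_, fun x _ => rfl⟩, ?_, ?_⟩
  · refine (hscale hg.smooth).comp hns.contDiffOn fun x hx => ?_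
    have := hball x hx
    exact ⟨by linarith [this.1], this.2⟩
  · refine (hscale hg.contDiffOn_two).comp hns.contDiffOn fun x hx => ?_
    have := hcball ‖x‖ ⟨norm_nonneg _, by simpa using hx⟩
    exact ⟨by linarith [this.1], by linarith [this.2]⟩
  · exact fun x hx => mul_pos hc (hg.pos _ (hball x hx))
  · intro r hr t ht hrt
    refine mul_lt_mul_of_pos_left (hg.strictAntiOn (hcball r hr) (hcball t ht) ?_) hc
    exact mul_lt_mul_of_pos_left (pow_lt_pow_left₀ hrt hr.1 two_ne_zero) hs₀
  · intro x hx hx0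
    have hx2 : 0 < ‖x‖ ^ 2 := pow_pos (norm_pos_iff.2 hx0) 2
    have hmem := hball x hx
    have hmem' : s₀ * ‖x‖ ^ 2 ∈ Ioo 0 s₀ := ⟨by positivity, hmem.2⟩
    have hopen : IsOpen ((fun t => s₀ * t) ⁻¹' Ioo (-ε) (s₀ + ε)) :=
      isOpen_Ioo.preimage (by fun_prop)
    rw [cordesOp_comp_norm_sq γ hopen (hscale hg.contDiffOn_two)
      ⟨by linarith [hmem.1], by linarith [hmem.2]⟩ hx0]
    have hdG : deriv G = fun t => c * (s₀ * deriv g (s₀ * t)) := by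
      ext t
      simp only [hG, deriv_const_mul_field, deriv_comp_mul_left, smul_eq_mul]
    have hddG : deriv (deriv G) = fun t => c * (s₀ * (s₀ * deriv (deriv g) (s₀ * t))) := by
      rw [hdG]
      ext t
      simp only [deriv_const_mul_field, deriv_comp_mul_left (f := deriv g), smul_eq_mul]
    have hode := hg.ode _ hmem'
    rw [hddG, hdG]
    simp only [hG]
    rw [Real.mul_rpow hc.le (hg.pos _ hmem).le, hcp,
      show g (s₀ * ‖x‖ ^ 2) ^ p = -(s₀ * ‖x‖ ^ 2 * deriv (deriv g) (s₀ * ‖x‖ ^ 2) +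
        (N + γ) / (2 * (1 + γ)) * deriv g (s₀ * ‖x‖ ^ 2)) by rw [hode, neg_neg] ]
    field_simp
    ring
  · intro x hx
    rw [mem_sphere_zero_iff_norm] at hx
    simp [hG, hx, hg.eq_zero]

theorem theorem4 (N : ℕ) (hN : 3 ≤ N) :
    (∀ γ p : ℝ, 0 < γ → γ < (N : ℝ) - 2 →
      1 < p → p < ((N : ℝ) + 2 + 3 * γ) / ((N : ℝ) - 2 - γ) →
      ∃ w : EuclideanSpace ℝ (Fin N) → ℝ, IsPosSmoothRadialDecSolution N γ p w) ∧
    (∀ γ p : ℝ, (N : ℝ) - 2 ≤ γ → 1 < p →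
      ∃ w : EuclideanSpace ℝ (Fin N) → ℝ, IsPosSmoothRadialDecSolution N γ p w) := by
  have hN' : (3 : ℝ) ≤ N := by exact_mod_cast hN
  refine ⟨fun γ p hγ hγN hp hpc => ?_, fun γ p hγN hp => ?_⟩
  · rw [lt_div_iff₀ (by linarith)] at hpc
    exact exists_isPosSmoothRadialDecSolution hγ hp (by linarith)
  -- Here `N + γ ≤ 2 (1 + γ)`, so every `p > 1` is subcritical.
  · exact exists_isPosSmoothRadialDecSolution (by linarith) hp (by nlinarith)
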